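/- Let $n\ge 3$ and let $(s_j)_{j\ge 0}$ be a binary m-sequence of order $n$, i.e. a nonzero sequence over $\mathbb F_2$ satisfying a linear recurrence $s_{j+n}=c_{n-1}s_{j+n-1}+\cdots+c_0s_j$ ($j\ge 0$) whose characteristic polynomial $x^n+c_{n-1}x^{n-1}+\cdots+c_0$ is primitive of degree $n$ over $\mathbb F_2$ (the minimal polynomial of a generator of $\mathbb F_{2^n}^*$). For $n\le t\le 2^n-1$ let $G_t=(s_{i+j})_{0\le i\le n-1,\,0\le j\le t-1}\in\mathbb F_2^{n\times t}$, and let $\mathcal C_t\subseteq\mathbb F_2^t$ be the binary linear code generated by the rows of $G_t$ (a punctured cyclic simplex code). For a binary linear code $\mathcal C$, let $\mathrm{Hull}(\mathcal C)=\mathcal C\cap\mathcal C^\perp$, where $\mathcal C^\perp$ is the dual for the Euclidean inner product; $\mathcal C$ is called LCD if $\mathrm{Hull}(\mathcal C)=\{0\}$ and self-orthogonal if $\mathcal C\subseteq\mathcal C^\perp$. Then for each integer $0\le h\le n$, $$\#\{\,n\le t\le 2^n-1 \mid \dim\mathrm{Hull}(\mathcal C_t)=h\,\}=\begin{cases}2^{n-1}-2,&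 h=0,\\ 2^{n-h-1}-1,& 1\le h\le n-2,\\ 1,& h=n-1,\\ 1,& h=n.\end{cases}$$ In particular, in the family $\{\mathcal C_t\mid n\le t\le 2^n-1\}$ there are exactly $2^{n-1}-2$ LCD codes and exactly one self-orthogonal code, namely $\mathcal C_{2^n-1}$. -/

import Mathlib

open Polynomial

namespace MSeq

/-- A binary primitive polynomial of degree `n` (for `n ≥ 1`): the minimal polynomial over `𝔽₂`
of a primitive element of `𝔽_{2^n}`, that is, of a generator of the multiplicative group. -/
def IsPrimitivePolynomial (n : ℕ) (f : (ZMod 2)[X]) : Prop :=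
  ∃ α : (GaloisField 2 n)ˣ, (∀ x : (GaloisField 2 n)ˣ, x ∈ Subgroup.zpowers α) ∧
    minpoly (ZMod 2) (α : GaloisField 2 n) = f

/-- `s` is a binary m-sequence of order `n`: a nonzero sequence satisfying a linear recurrence
`s (k + n) = ∑ i, c i * s (k + i)` over `𝔽₂` whose characteristic polynomial
`X ^ n - ∑ i, c i * X ^ i` is a primitive polynomial of degree `n`. -/
def IsMSequence (n : ℕ) (s : ℕ → ZMod 2) : Prop :=
  ∃ E : LinearRecurrence (ZMod 2), E.order = n ∧ IsPrimitivePolynomial n E.charPoly ∧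
    E.IsSolution s ∧ s ≠ 0

/-- The `n × t` observability matrix of `s`, whose `(i, j)` entry (indices from `0`) is
`s (i + j)`. -/
def observabilityMatrix (s : ℕ → ZMod 2) (n t : ℕ) : Matrix (Fin n) (Fin t) (ZMod 2) :=
  Matrix.of fun i j => s ((i : ℕ) + (j : ℕ))

/-- The binary linear code of length `t` generated by (the rows of) an `n × t` matrix. -/
def codeGeneratedBy {n t : ℕ} (G : Matrix (Fin n) (Fin t) (ZMod 2)) :
    Submodule (ZMod 2) (Fin t → ZMod 2) :=
  Submodule.span (ZMod 2) (Set.range fun i => G i)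

/-- The code `C_t` generated by the observability matrix `G_t`. -/
def code (s : ℕ → ZMod 2) (n t : ℕ) : Submodule (ZMod 2) (Fin t → ZMod 2) :=
  codeGeneratedBy (observabilityMatrix s n t)

/-- The Euclidean dual code. -/
def dualCode {t : ℕ} (C : Submodule (ZMod 2) (Fin t → ZMod 2)) :
    Submodule (ZMod 2) (Fin t → ZMod 2) :=
  C.orthogonalBilin (dotProductBilin (ZMod 2) (ZMod 2))

/-- Membership in the dual code, spelled out. -/
theorem mem_dualCode {t : ℕ} (C : Submodule (ZMod 2) (Fin t → ZMod 2)) (v : Fin t → ZMod 2) :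
    v ∈ dualCode C ↔ ∀ u ∈ C, ∑ r, u r * v r = 0 :=
  Iff.rfl

/-- The hull of a code. -/
def hull {t : ℕ} (C : Submodule (ZMod 2) (Fin t → ZMod 2)) :
    Submodule (ZMod 2) (Fin t → ZMod 2) :=
  C ⊓ dualCode C

/-- Linear complementary dual codes. -/
def IsLCD {t : ℕ} (C : Submodule (ZMod 2) (Fin t → ZMod 2)) : Prop :=
  hull C = ⊥

/-- Self-orthogonal codes. -/
def IsSelfOrthogonal {t : ℕ} (C : Submodule (ZMod 2) (Fin t → ZMod 2)) : Prop :=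
  C ≤ dualCode C

/-- The number of `t` with `n ≤ t ≤ 2 ^ n - 1` for which the hull of `C_t` has dimension `h`. -/
noncomputable def hullCount (s : ℕ → ZMod 2) (n h : ℕ) : ℕ :=
  {t : ℕ | n ≤ t ∧ t ≤ 2 ^ n - 1 ∧ Module.finrank (ZMod 2) (hull (code s n t)) = h}.ncard

end MSeq

/-! Let `f` be the characteristic polynomial, `α` a primitive root of it, `f*` its reflection, and
read a word of length `t` as a polynomial `p` of degree below `t`. The word lies in the dual code
iff `p(α) = 0`, and in the code iff `f* p = B - X^t A` with `A`, `B` of degree below `n`. Since `f*`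
vanishes at `α⁻¹` but not at `α`, hull words correspond to pairs `(A, B)` for which `B - X^t A`
vanishes at both `α` and `α⁻¹` (`word_mem_hull_iff`).

The conjugates of `α` and `α⁻¹` are `2n` distinct points, so two such pairs have zero cross product.
All of them are therefore multiples of one coprime pair, which symmetry under reflection forces to
be `(P*, P)` (`exists_generator`). If `d` bounds its degrees minimally, the multipliers have degree
below `n - d`, and the hull has dimension `n - d` (`finrank_hull`).

It remains to count the `t` modulo `2^n - 1` of index `d`. For `m < n`, each nonzero `P` of degree
at most `m` determines `α^t = P(α)/P*(α)`, hence exactly one `t`. Conversely, a `t` of index `e ≤ m`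
receives the nonzero palindromic multiples of its generator. This double count (`sum_idxCount_mul`)
is a triangular system determining the number of `t` of each index below `n`; index `n` takes the
rest. Finally the range `0 ≤ t < 2^n - 1` is traded for `n ≤ t ≤ 2^n - 1`. -/

namespace MSeq

/-! ### Conjugates of `α` and `α⁻¹`, and polynomials vanishing there. -/

section Roots

variable {n : ℕ} {K : Type*} [Field K] {α : K}

theorem orderOf_inv_eq (x : K) : orderOf x⁻¹ = orderOf x := by
  rw [orderOf_eq_orderOf_iff]
  intro m
  rw [inv_pow, inv_eq_one]

theorem eq_of_pow_two_pow_eq (hα : orderOf α = 2 ^ n - 1) {i j : ℕ} (hi : i < n) (hj : j < n)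
    (h : α ^ 2 ^ i = α ^ 2 ^ j) : i = j := by
  have key : ∀ k < n, 2 ^ k < 2 ^ n - 1 ∨ n = 1 := by
    intro k hk
    have h1 : 2 ^ (k + 1) ≤ 2 ^ n := Nat.pow_le_pow_right (by norm_num) hk
    rcases Nat.eq_zero_or_pos k with rfl | hk0
    · rcases Nat.lt_or_ge 1 n with h2 | h2
      · have : 2 ^ 2 ≤ 2 ^ n := Nat.pow_le_pow_right (by norm_num) h2
        left; omega
      · right; omega
    · have : 2 ^ 1 ≤ 2 ^ k := Nat.pow_le_pow_right (by norm_num) hk0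
      left; rw [pow_succ] at h1; omega
  rcases key i hi with h1 | h1
  · rcases key j hj with h2 | h2
    · have := pow_injOn_Iio_orderOf (x := α) (by simpa [hα] using h1) (by simpa [hα] using h2) h
      exact Nat.pow_right_injective le_rfl this
    · omega
  · omega

/-- Equality would make `2^n - 1` divide `2^i + 2^j`. That sum is `2^n` when `i = j = n - 1`, and
otherwise at most `2^(n-1) + 2^(n-2) < 2^n - 1`. For `n = 2` the claim fails, since `3 = 1 + 2`. -/
theorem inv_pow_two_pow_ne (hn : 3 ≤ n) (hα : orderOf α = 2 ^ n - 1) {i j : ℕ} (hi : i < n)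
    (hj : j < n) : α ^ 2 ^ i ≠ α⁻¹ ^ 2 ^ j := by
  intro h
  have h8 : 2 ^ 3 ≤ 2 ^ n := Nat.pow_le_pow_right (by norm_num) hn
  have hα0 : α ≠ 0 := by
    rintro rfl
    have := orderOf_zero K
    omega
  have h1 : α ^ (2 ^ i + 2 ^ j) = 1 := by
    rw [pow_add, h, ← mul_pow, inv_mul_cancel₀ hα0, one_pow]
  have h2 : 2 ^ n - 1 ∣ 2 ^ i + 2 ^ j := hα ▸ orderOf_dvd_of_pow_eq_one h1
  obtain ⟨m, rfl⟩ : ∃ m, n = m + 1 := ⟨n - 1, by omega⟩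
  rw [pow_succ] at h2 h8
  have key : ∀ k < m + 1, k = m ∨ 2 * 2 ^ k ≤ 2 ^ m := by
    intro k hk
    rcases Nat.lt_or_ge k m with h | h
    · right
      rw [mul_comm, ← pow_succ]
      exact Nat.pow_le_pow_right (by norm_num) h
    · left; omega
  have hip : 0 < 2 ^ i := by positivity
  have hjp : 0 < 2 ^ j := by positivity
  rcases key i hi with rfl | hi'
  · rcases key j hj with rfl | hj'
    · have : 2 ^ j * 2 - 1 ∣ 1 := by
        have h3 := Nat.dvd_sub h2 (dvd_refl (2 ^ j * 2 - 1))
        rwa [show 2 ^ j + 2 ^ j - (2 ^ j * 2 - 1) = 1 by omega] at h3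
      have := Nat.dvd_one.1 this
      omega
    · have := Nat.le_of_dvd (by omega) h2
      omega
  · have h3 := Nat.le_of_dvd (by omega) h2
    rcases key j hj with rfl | hj' <;> omega

variable [Algebra (ZMod 2) K]

theorem aeval_pow_two_pow (p : (ZMod 2)[X]) (x : K) (i : ℕ) :
    aeval (x ^ 2 ^ i) p = aeval x p ^ 2 ^ i := by
  induction i with
  | zero => simp
  | succ i ih =>
    have h := aeval_algHom_apply (FiniteField.frobeniusAlgHom (ZMod 2) K) (x ^ 2 ^ i) p
    simp only [FiniteField.frobeniusAlgHom_apply, ZMod.card] at h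
    rw [pow_succ, pow_mul, h, ih, ← pow_mul]

/-- A polynomial over `𝔽₂` of degree less than `n` vanishing at an element of order `2 ^ n - 1`
is zero. -/
theorem eq_zero_of_aeval (hα : orderOf α = 2 ^ n - 1) {p : (ZMod 2)[X]} (hp : p.natDegree < n)
    (h : aeval α p = 0) : p = 0 := by
  have : p.map (algebraMap (ZMod 2) K) = 0 := by
    refine eq_zero_of_natDegree_lt_card_of_eval_eq_zero _ (f := fun i : Fin n => α ^ 2 ^ (i : ℕ))
      (fun i j hij => Fin.ext (eq_of_pow_two_pow_eq hα i.2 j.2 hij)) (fun i => ?_) ?_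
    · rw [eval_map_algebraMap, aeval_pow_two_pow, h, zero_pow (by positivity)]
    · simpa using hp
  simpa [Polynomial.map_eq_zero] using this

/-- A polynomial over `𝔽₂` of degree less than `2 * n` vanishing at an element of order `2 ^ n - 1`
and at its inverse is zero. -/
theorem eq_zero_of_aeval_of_aeval_inv (hn : 3 ≤ n) (hα : orderOf α = 2 ^ n - 1)
    {p : (ZMod 2)[X]} (hp : p.natDegree < 2 * n)
    (h : aeval α p = 0) (h' : aeval α⁻¹ p = 0) : p = 0 := by
  have hinv : Function.Injective (Sum.elim (fun i : Fin n => α ^ 2 ^ (i : ℕ))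
      (fun i : Fin n => α⁻¹ ^ 2 ^ (i : ℕ))) := by
    rintro (i | i) (j | j) hij
    · exact congrArg _ (Fin.ext (eq_of_pow_two_pow_eq hα i.2 j.2 hij))
    · exact (inv_pow_two_pow_ne hn hα i.2 j.2 hij).elim
    · exact (inv_pow_two_pow_ne hn hα j.2 i.2 hij.symm).elim
    · refine congrArg _ (Fin.ext (eq_of_pow_two_pow_eq hα i.2 j.2 ?_))
      simpa using hij
  have : p.map (algebraMap (ZMod 2) K) = 0 := by
    refine eq_zero_of_natDegree_lt_card_of_eval_eq_zero _ hinv (fun i => ?_) ?_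
    · rcases i with i | i
      · simp only [Sum.elim_inl]
        rw [eval_map_algebraMap, aeval_pow_two_pow, h, zero_pow (by positivity)]
      · simp only [Sum.elim_inr]
        rw [eval_map_algebraMap, aeval_pow_two_pow, h', zero_pow (by positivity)]
    · simpa [two_mul] using hp
  simpa [Polynomial.map_eq_zero] using this

theorem natDegree_reflect_le_of_le {R : Type*} [Semiring R] {p : R[X]} {N : ℕ}
    (h : p.natDegree ≤ N) : (reflect N p).natDegree ≤ N :=
  natDegree_reflect_le.trans (max_le le_rfl h)

theorem aeval_reflect {x : K} (hx : x ≠ 0) {p : (ZMod 2)[X]} {N : ℕ} (h : p.natDegree ≤ N) :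
    aeval x (reflect N p) = x ^ N * aeval x⁻¹ p := by
  let _ := invertibleOfNonzero (inv_ne_zero hx)
  have := eval₂_reflect_mul_pow (algebraMap (ZMod 2) K) x⁻¹ N p h
  simp only [invOf_eq_inv, inv_inv] at this
  rw [aeval_def, aeval_def, ← this, mul_comm, mul_assoc, inv_pow, inv_mul_cancel₀ (pow_ne_zero _ hx),
    mul_one]

end Roots

/-! ### Pairs related at `α` and `α⁻¹`, and their common generator. -/

section Pairs

variable {n : ℕ} {K : Type*} [Field K] [Algebra (ZMod 2) K]

/-- The polynomial `B - X ^ t * A` vanishes at `α` and at `α⁻¹`. -/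
def Rel (α : K) (t : ℕ) (A B : (ZMod 2)[X]) : Prop :=
  aeval α B = α ^ t * aeval α A ∧ aeval α⁻¹ B = α⁻¹ ^ t * aeval α⁻¹ A

variable {α : K} {t : ℕ} {A B a b : (ZMod 2)[X]}

theorem Rel.mul_left (h : Rel α t A B) (g : (ZMod 2)[X]) : Rel α t (g * A) (g * B) := by
  refine ⟨?_, ?_⟩
  · rw [map_mul, map_mul, h.1]; ring
  · rw [map_mul, map_mul, h.2]; ring

theorem Rel.reflect (hα0 : α ≠ 0) {d : ℕ} (hA : A.natDegree ≤ d) (hB : B.natDegree ≤ d)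
    (h : Rel α t A B) : Rel α t (reflect d B) (reflect d A) := by
  have hi := inv_ne_zero hα0
  refine ⟨?_, ?_⟩
  · rw [aeval_reflect hα0 hA, aeval_reflect hα0 hB, h.2, inv_pow]
    field_simp
  · rw [aeval_reflect hi hA, aeval_reflect hi hB, inv_inv, h.1, inv_pow, inv_pow]
    field_simp

/-- The difference `A b - B a` vanishes at `α` and `α⁻¹`, yet has degree at most `2n - 2`, fewer
than its `2n` roots. -/
theorem Rel.cross_eq (hn : 3 ≤ n) (hα : orderOf α = 2 ^ n - 1)
    (hA : A.natDegree < n) (hB : B.natDegree < n) (ha : a.natDegree < n) (hb : b.natDegree < n)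
    (h : Rel α t A B) (h' : Rel α t a b) : A * b = B * a := by
  rw [← sub_eq_zero]
  refine eq_zero_of_aeval_of_aeval_inv hn hα ?_ ?_ ?_
  · have h1 := natDegree_sub_le (A * b) (B * a)
    have h2 := natDegree_mul_le (p := A) (q := b)
    have h3 := natDegree_mul_le (p := B) (q := a)
    omega
  · rw [map_sub, map_mul, map_mul, h.1, h'.1]; ring
  · rw [map_sub, map_mul, map_mul, h.2, h'.2]; ring

theorem Rel.right_ne_zero (hα : orderOf α = 2 ^ n - 1) (hα0 : α ≠ 0) (hA : A.natDegree < n)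
    (h0 : A ≠ 0) (h : Rel α t A B) : B ≠ 0 := by
  rintro rfl
  refine h0 (eq_zero_of_aeval hα hA ?_)
  have := h.1
  simpa [hα0] using this.symm

theorem Rel.left_ne_zero (hα : orderOf α = 2 ^ n - 1) (hB : B.natDegree < n)
    (h0 : B ≠ 0) (h : Rel α t A B) : A ≠ 0 := by
  rintro rfl
  refine h0 (eq_zero_of_aeval hα hB ?_)
  simpa using h.1

theorem Rel.of_mul_left (hα : orderOf α = 2 ^ n - 1) {g : (ZMod 2)[X]} (hg : g ≠ 0)
    (hgn : g.natDegree < n) (h : Rel α t (g * A) (g * B)) : Rel α t A B := by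
  have h1 : aeval α g ≠ 0 := fun h0 => hg (eq_zero_of_aeval hα hgn h0)
  have h2 : aeval α⁻¹ g ≠ 0 := fun h0 =>
    hg (eq_zero_of_aeval (α := α⁻¹) (by rwa [orderOf_inv_eq]) hgn h0)
  refine ⟨mul_left_cancel₀ h1 ?_, mul_left_cancel₀ h2 ?_⟩
  · rw [← map_mul, h.1, map_mul]; ring
  · rw [← map_mul, h.2, map_mul]; ring

/-- The least `d` for which some nonzero pair of polynomials of degree at most `d` is related
by `Rel α t`, capped at `n`. -/
noncomputable def idx (n : ℕ) (α : K) (t : ℕ) : ℕ :=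
  sInf {d | d = n ∨ ∃ A B : (ZMod 2)[X], A ≠ 0 ∧ A.natDegree ≤ d ∧ B.natDegree ≤ d ∧ Rel α t A B}

theorem idx_le : idx n α t ≤ n := Nat.sInf_le (Or.inl rfl)

theorem idx_le_of_rel {d : ℕ} (h0 : A ≠ 0) (hA : A.natDegree ≤ d) (hB : B.natDegree ≤ d)
    (h : Rel α t A B) : idx n α t ≤ d :=
  Nat.sInf_le (Or.inr ⟨A, B, h0, hA, hB, h⟩)

theorem exists_rel_of_idx_lt (h : idx n α t < n) : ∃ A B : (ZMod 2)[X],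
    A ≠ 0 ∧ A.natDegree ≤ idx n α t ∧ B.natDegree ≤ idx n α t ∧ Rel α t A B := by
  have hne : {d | d = n ∨ ∃ A B : (ZMod 2)[X], A ≠ 0 ∧ A.natDegree ≤ d ∧ B.natDegree ≤ d ∧
      Rel α t A B}.Nonempty := ⟨n, Or.inl rfl⟩
  rcases Nat.sInf_mem hne with h1 | h1
  · exact absurd h1 h.ne
  · exact h1

/-- The pairs of polynomials of degree less than `n` related by `Rel α t` are the multiples of
a single pair, whose entries are reflections of each other. -/
theorem exists_generator (hn : 3 ≤ n) (hα : orderOf α = 2 ^ n - 1) (hα0 : α ≠ 0)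
    (h : idx n α t < n) : ∃ P : (ZMod 2)[X], P ≠ 0 ∧ P.natDegree ≤ idx n α t ∧
      Rel α t (reflect (idx n α t) P) P ∧
      ∀ (A B : (ZMod 2)[X]) (m : ℕ), m < n → A ≠ 0 → A.natDegree ≤ m → B.natDegree ≤ m →
        Rel α t A B → ∃ g : (ZMod 2)[X], g.natDegree + idx n α t ≤ m ∧
          A = g * reflect (idx n α t) P ∧ B = g * P := by
  obtain ⟨A₀, B₀, hA₀, hdA, hdB, hrel⟩ := exists_rel_of_idx_lt h
  set d := idx n α t with hd
  -- Dividing by the gcd keeps the pair related, since a nonzero polynomial of degree below `n`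
  -- vanishes at neither `α` nor `α⁻¹`.
  obtain ⟨a, b, hcop, ha0, ha, hb, hab⟩ : ∃ a b : (ZMod 2)[X], IsCoprime a b ∧ a ≠ 0 ∧
      a.natDegree ≤ d ∧ b.natDegree ≤ d ∧ Rel α t a b := by
    obtain ⟨a, haA⟩ := EuclideanDomain.gcd_dvd_left A₀ B₀
    obtain ⟨b, hbB⟩ := EuclideanDomain.gcd_dvd_right A₀ B₀
    have hbez := EuclideanDomain.gcd_eq_gcd_ab A₀ B₀
    set g := EuclideanDomain.gcd A₀ B₀ with hg
    have hg0 : g ≠ 0 := by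
      rintro h0
      rw [h0, zero_mul] at haA
      exact hA₀ haA
    have ha0 : a ≠ 0 := by
      rintro rfl
      exact hA₀ (by rw [haA, mul_zero])
    have hB₀ : B₀ ≠ 0 := hrel.right_ne_zero hα hα0 (by omega) hA₀
    have hb0 : b ≠ 0 := by
      rintro rfl
      exact hB₀ (by rw [hbB, mul_zero])
    have hda : A₀.natDegree = g.natDegree + a.natDegree := by
      conv_lhs => rw [haA]
      exact natDegree_mul hg0 ha0
    have hdb : B₀.natDegree = g.natDegree + b.natDegree := by
      conv_lhs => rw [hbB]
      exact natDegree_mul hg0 hb0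
    refine ⟨a, b, ⟨EuclideanDomain.gcdA A₀ B₀, EuclideanDomain.gcdB A₀ B₀, ?_⟩, ha0, by omega,
      by omega, ?_⟩
    · refine mul_left_cancel₀ hg0 ?_
      calc g * (EuclideanDomain.gcdA A₀ B₀ * a + EuclideanDomain.gcdB A₀ B₀ * b)
          = (g * a) * EuclideanDomain.gcdA A₀ B₀ + (g * b) * EuclideanDomain.gcdB A₀ B₀ := by ring
        _ = g * 1 := by rw [← haA, ← hbB, ← hbez, mul_one]
    · rw [haA, hbB] at hrel
      exact hrel.of_mul_left hα hg0 (by omega)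
  have hb0 : b ≠ 0 := hab.right_ne_zero hα hα0 (by omega) ha0
  -- Minimality of `d`: one of `a`, `b` attains degree `d`, which bounds the degree of every
  -- multiplier.
  have hmax : d ≤ max a.natDegree b.natDegree :=
    idx_le_of_rel ha0 (le_max_left _ _) (le_max_right _ _) hab
  have hgen : ∀ (A B : (ZMod 2)[X]) (m : ℕ), m < n → A ≠ 0 → A.natDegree ≤ m →
      B.natDegree ≤ m → Rel α t A B → ∃ g : (ZMod 2)[X], g.natDegree + d ≤ m ∧
        A = g * a ∧ B = g * b := by
    intro A B m hm hA0 hA hB hAB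
    have hcross : A * b = B * a := Rel.cross_eq hn hα (by omega) (by omega) (by omega) (by omega)
      hAB hab
    obtain ⟨g, rfl⟩ : a ∣ A := hcop.dvd_of_dvd_mul_right ⟨B, by rw [hcross, mul_comm]⟩
    have hBg : B = g * b := by
      refine mul_right_cancel₀ ha0 ?_
      rw [← hcross]; ring
    have hg0 : g ≠ 0 := by
      rintro rfl
      simp at hA0
    refine ⟨g, ?_, mul_comm _ _, hBg⟩
    rw [natDegree_mul ha0 hg0] at hA
    rw [hBg, natDegree_mul hg0 hb0] at hB
    rcases le_max_iff.1 hmax with h1 | h1 <;> omega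
  -- The reflected pair is again related and within degree `d`, so its multiplier is a nonzero
  -- constant, which over `𝔽₂` is `1`.
  obtain ⟨g, hgd, hg1, hg2⟩ := hgen (reflect d b) (reflect d a) d h
    (by rwa [Ne, reflect_eq_zero_iff]) (natDegree_reflect_le_of_le hb)
    (natDegree_reflect_le_of_le ha) (hab.reflect hα0 ha hb)
  have hg : g = 1 := by
    obtain ⟨c, rfl⟩ : ∃ c, g = C c := ⟨_, eq_C_of_natDegree_eq_zero (by omega)⟩
    have hc : c ≠ 0 := by
      rintro rfl
      rw [map_zero, zero_mul, reflect_eq_zero_iff] at hg1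
      exact hb0 hg1
    have : ∀ c : ZMod 2, c ≠ 0 → c = 1 := by decide
    rw [this c hc, map_one]
  rw [hg, one_mul] at hg1
  exact ⟨b, hb0, hb, hg1 ▸ hab, hg1 ▸ hgen⟩

end Pairs

/-! ### Counting lengths by index. -/

section Counting

/-- The polynomials over `𝔽₂` of degree at most `m`. -/
noncomputable def polys (m : ℕ) : Finset (ZMod 2)[X] :=
  Finset.univ.map ⟨fun v : Fin (m + 1) → ZMod 2 => ((degreeLTEquiv (ZMod 2) (m + 1)).symm v : _),
    Subtype.val_injective.comp (LinearEquiv.injective _)⟩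

theorem mem_polys {m : ℕ} {p : (ZMod 2)[X]} : p ∈ polys m ↔ p.natDegree ≤ m := by
  have h : p ∈ degreeLT (ZMod 2) (m + 1) ↔ p.natDegree ≤ m := by
    rw [degreeLT_succ_eq_degreeLE, mem_degreeLE, natDegree_le_iff_degree_le]
  rw [← h, polys, Finset.mem_map]
  constructor
  · rintro ⟨v, -, rfl⟩
    exact Subtype.property _
  · intro hp
    exact ⟨degreeLTEquiv (ZMod 2) (m + 1) ⟨p, hp⟩, Finset.mem_univ _, by simp⟩

theorem card_polys (m : ℕ) : (polys m).card = 2 ^ (m + 1) := by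
  simp [polys]

theorem coeff_degreeLTEquiv_symm {R : Type*} [CommRing R] {m : ℕ} (v : Fin m → R) (i : Fin m) :
    ((degreeLTEquiv R m).symm v : R[X]).coeff i = v i :=
  congrFun ((degreeLTEquiv R m).apply_symm_apply v) i

-- A palindrome of formal degree `k` is freely determined by its coefficients at `0, …, ⌊k/2⌋`; the
-- inverse map copies the coefficient at `min i (k - i)`.
open Classical in
theorem card_palindromes (k : ℕ) :
    ((polys k).filter fun g => reflect k g = g).card = 2 ^ (k / 2 + 1) := by
  have hcard : (Finset.univ : Finset (Fin (k / 2 + 1) → ZMod 2)).card = 2 ^ (k / 2 + 1) := by simp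
  rw [← hcard]
  refine Finset.card_bij' (fun g _ (i : Fin (k / 2 + 1)) => g.coeff i)
    (fun v _ => ((degreeLTEquiv (ZMod 2) (k + 1)).symm fun i : Fin (k + 1) =>
      v ⟨min i (k - i), by omega⟩ : (ZMod 2)[X])) (fun _ _ => Finset.mem_univ _) ?_ ?_ ?_
  · intro v _
    set p : (ZMod 2)[X] := ((degreeLTEquiv (ZMod 2) (k + 1)).symm fun i : Fin (k + 1) =>
      v ⟨min i (k - i), by omega⟩ : (ZMod 2)[X]) with hp
    have hpd : p.natDegree ≤ k := mem_polys.1 (Finset.mem_map.2 ⟨_, Finset.mem_univ _, rfl⟩)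
    rw [Finset.mem_filter, mem_polys]
    refine ⟨hpd, ?_⟩
    ext i
    rw [coeff_reflect]
    rcases Nat.lt_or_ge k i with hi | hi
    · rw [revAt_eq_self_of_lt hi]
    · rw [revAt_le hi]
      have h1 := coeff_degreeLTEquiv_symm (fun i : Fin (k + 1) =>
        v ⟨min i (k - i), by omega⟩) ⟨k - i, by omega⟩
      have h2 := coeff_degreeLTEquiv_symm (fun i : Fin (k + 1) =>
        v ⟨min i (k - i), by omega⟩) ⟨i, by omega⟩
      rw [← hp] at h1 h2
      simp only at h1 h2
      rw [h1, h2]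
      congr 2
      omega
  · intro g hg
    rw [Finset.mem_filter, mem_polys] at hg
    ext i
    rcases Nat.lt_or_ge k i with hi | hi
    · rw [coeff_eq_zero_of_natDegree_lt (hg.1.trans_lt hi)]
      refine coeff_eq_zero_of_natDegree_lt (lt_of_le_of_lt ?_ hi)
      exact mem_polys.1 (Finset.mem_map.2 ⟨_, Finset.mem_univ _, rfl⟩)
    · refine (coeff_degreeLTEquiv_symm _ ⟨i, by omega⟩).trans ?_
      simp only
      rcases le_total i (k - i) with h | h
      · rw [min_eq_left h]
      · rw [min_eq_right h]
        conv_rhs => rw [← hg.2, coeff_reflect, revAt_le hi]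
  · intro v _
    funext i
    refine (coeff_degreeLTEquiv_symm _ ⟨(i : ℕ), by omega⟩).trans ?_
    simp only
    congr 1
    ext
    simp only
    omega

variable {n : ℕ} {K : Type*} [Field K] [Algebra (ZMod 2) K] {α : K} {t : ℕ}

theorem idx_of_pow_eq_one (ht : α ^ t = 1) : idx n α t = 0 := by
  have h : Rel α t 1 1 := by simp [Rel, ht]
  exact Nat.le_zero.1 (idx_le_of_rel one_ne_zero (by simp) (by simp) h)

theorem idx_of_lt (hn : 3 ≤ n) (hα : orderOf α = 2 ^ n - 1) (hα0 : α ≠ 0) (ht : t < n) :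
    idx n α t = t := by
  refine le_antisymm ?_ ?_
  · have h : Rel α t 1 (X ^ t) := by simp [Rel]
    exact idx_le_of_rel one_ne_zero (by simp) (by simp) h
  · by_contra! hlt
    obtain ⟨A, B, hA0, hA, hB, h⟩ := exists_rel_of_idx_lt (hlt.trans ht)
    have hB0 := h.right_ne_zero hα hα0 (by omega) hA0
    have hX : (X ^ t * A).natDegree = t + A.natDegree := by
      rw [natDegree_mul (pow_ne_zero _ X_ne_zero) hA0, natDegree_X_pow]
    -- All degrees stay below `2n`, so the relation is a polynomial identity `B = X^t A`, impossible
    -- when `deg B < t`.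
    have : B - X ^ t * A = 0 := by
      refine eq_zero_of_aeval_of_aeval_inv hn hα ?_ ?_ ?_
      · have := natDegree_sub_le B (X ^ t * A)
        omega
      · simp [h.1]
      · simp [h.2]
    have h2 := congrArg natDegree (sub_eq_zero.1 this)
    omega

/-- For a polynomial and its reflection, the condition at `α⁻¹` follows from the one at `α`. -/
theorem rel_reflect_iff (hα0 : α ≠ 0) {m : ℕ} {P : (ZMod 2)[X]} (hP : P.natDegree ≤ m) :
    Rel α t (reflect m P) P ↔ aeval α P = α ^ t * aeval α (reflect m P) := by
  refine ⟨fun h => h.1, fun h => ⟨h, ?_⟩⟩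
  rw [aeval_reflect (inv_ne_zero hα0) hP, inv_inv, h, aeval_reflect hα0 hP, inv_pow, inv_pow]
  field_simp

-- With `P` the generator of index `d`, a solution `g P` satisfies the reflected relation exactly
-- when `g` is a palindrome of formal degree `m - d`.
open Classical in
theorem card_rel_reflect (hn : 3 ≤ n) (hα : orderOf α = 2 ^ n - 1) (hα0 : α ≠ 0) {m : ℕ}
    (hm : m < n) (ht : idx n α t ≤ m) :
    ((polys m).filter fun P => P ≠ 0 ∧ Rel α t (reflect m P) P).card =
      2 ^ ((m - idx n α t) / 2 + 1) - 1 := by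
  obtain ⟨P, hP0, hPd, hPrel, hgen⟩ := exists_generator hn hα hα0 (ht.trans_lt hm)
  set d := idx n α t
  have hrefl : ∀ g : (ZMod 2)[X], g.natDegree ≤ m - d →
      reflect m (g * P) = reflect (m - d) g * reflect d P := by
    intro g hg
    rw [← reflect_mul g P hg hPd, Nat.sub_add_cancel ht]
  have hrP0 : reflect d P ≠ 0 := by rwa [Ne, reflect_eq_zero_iff]
  have hset : ((polys m).filter fun P => P ≠ 0 ∧ Rel α t (reflect m P) P) =
      (((polys (m - d)).filter fun g => reflect (m - d) g = g).erase 0).image (· * P) := by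
    ext Q
    simp only [Finset.mem_filter, mem_polys, Finset.mem_image, Finset.mem_erase]
    constructor
    · rintro ⟨hQd, hQ0, hQ⟩
      obtain ⟨g, hg, h1, rfl⟩ := hgen (reflect m Q) Q m hm (by rwa [Ne, reflect_eq_zero_iff])
        (natDegree_reflect_le_of_le hQd) hQd hQ
      have hgd : g.natDegree ≤ m - d := by omega
      refine ⟨g, ⟨left_ne_zero_of_mul hQ0, hgd, ?_⟩, rfl⟩
      rw [hrefl g hgd] at h1
      exact mul_right_cancel₀ hrP0 h1
    · rintro ⟨g, ⟨hg0, hgd, hg⟩, rfl⟩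
      refine ⟨natDegree_mul_le.trans (by omega), mul_ne_zero hg0 hP0, ?_⟩
      rw [hrefl g hgd, hg]
      exact hPrel.mul_left g
  rw [hset, Finset.card_image_of_injective _ (mul_left_injective₀ hP0),
    Finset.card_erase_of_mem (by simp [mem_polys]), card_palindromes]

-- Each nonzero polynomial of degree at most `m` is counted for exactly one `t`, because `α`
-- generates the nonzero elements and `P(α)`, `P*(α)` are nonzero.
open Classical in
theorem sum_card_rel_reflect (hα : orderOf α = 2 ^ n - 1) (hα0 : α ≠ 0)
    (hgen : ∀ x : K, x ≠ 0 → ∃ k : ℕ, α ^ k = x) {m : ℕ} (hm : m < n) :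
    ∑ t ∈ Finset.range (2 ^ n - 1),
      ((polys m).filter fun P => P ≠ 0 ∧ Rel α t (reflect m P) P).card = 2 ^ (m + 1) - 1 := by
  have hpos : 0 < 2 ^ n - 1 := by
    have : 2 ^ 1 ≤ 2 ^ n := Nat.pow_le_pow_right (by norm_num) (by omega)
    omega
  rw [← card_polys m, ← Finset.card_erase_of_mem (a := 0) (by simp [mem_polys]),
    ← Finset.card_biUnion]
  · congr 1
    ext P
    simp only [Finset.mem_biUnion, Finset.mem_range, Finset.mem_filter, mem_polys, Finset.mem_erase]
    constructor
    · rintro ⟨t, -, hP, hP0, -⟩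
      exact ⟨hP0, hP⟩
    · rintro ⟨hP0, hP⟩
      have h1 : aeval α P ≠ 0 := fun h => hP0 (eq_zero_of_aeval hα (hP.trans_lt hm) h)
      have h2 : aeval α (reflect m P) ≠ 0 := fun h =>
        hP0 (reflect_eq_zero_iff.1
          (eq_zero_of_aeval hα ((natDegree_reflect_le_of_le hP).trans_lt hm) h))
      obtain ⟨k, hk⟩ := hgen _ (div_ne_zero h1 h2)
      refine ⟨k % (2 ^ n - 1), Nat.mod_lt _ hpos, hP, hP0, (rel_reflect_iff hα0 hP).2 ?_⟩
      rw [← hα, pow_mod_orderOf, hk, div_mul_cancel₀ _ h2]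
  · intro t ht t' ht' hne
    rw [Function.onFun, Finset.disjoint_left]
    intro P hP hP'
    simp only [Finset.mem_filter, mem_polys] at hP hP'
    have h2 : aeval α (reflect m P) ≠ 0 := fun h =>
        hP.2.1 (reflect_eq_zero_iff.1
          (eq_zero_of_aeval hα ((natDegree_reflect_le_of_le hP.1).trans_lt hm) h))
    refine hne (pow_injOn_Iio_orderOf (x := α) ?_ ?_
      (mul_right_cancel₀ h2 (hP.2.2.1.symm.trans hP'.2.2.1)))
    · simpa [hα] using ht
    · simpa [hα] using ht'

/-- The number of `t < 2 ^ n - 1` of given index. -/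
noncomputable def idxCount (n : ℕ) (α : K) (e : ℕ) : ℕ :=
  ((Finset.range (2 ^ n - 1)).filter fun t => idx n α t = e).card

/-- The sum over `t` is grouped by index; a `t` of index above `m` contributes nothing. -/
theorem sum_idxCount_mul (hn : 3 ≤ n) (hα : orderOf α = 2 ^ n - 1) (hα0 : α ≠ 0)
    (hgen : ∀ x : K, x ≠ 0 → ∃ k : ℕ, α ^ k = x) {m : ℕ} (hm : m < n) :
    ∑ e ∈ Finset.range (m + 1), idxCount n α e * (2 ^ ((m - e) / 2 + 1) - 1) = 2 ^ (m + 1) - 1 := by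
  classical
  rw [← sum_card_rel_reflect hα hα0 hgen hm,
    ← Finset.sum_filter_add_sum_filter_not (Finset.range (2 ^ n - 1)) (fun t => idx n α t ∈ Finset.range (m + 1)),
    ← Finset.sum_fiberwise_of_maps_to (t := Finset.range (m + 1)) (g := fun t => idx n α t)
      (fun t ht => (Finset.mem_filter.1 ht).2),
    Finset.sum_eq_zero (s := (Finset.range (2 ^ n - 1)).filter fun t =>
      idx n α t ∉ Finset.range (m + 1)), add_zero]
  · refine Finset.sum_congr rfl fun e he => ?_
    rw [Finset.filter_filter, idxCount, ← smul_eq_mul, ← Finset.sum_const]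
    refine Finset.sum_congr ?_ fun t ht => ?_
    · ext t
      simp only [Finset.mem_filter]
      grind
    · simp only [Finset.mem_filter] at ht
      rw [card_rel_reflect hn hα hα0 hm (by grind), ht.2.2]
  · intro t ht
    simp only [Finset.mem_filter, Finset.mem_range, not_lt] at ht
    rw [Finset.card_eq_zero, Finset.filter_eq_empty_iff]
    rintro P hP ⟨hP0, hrel⟩
    rw [mem_polys] at hP
    have := idx_le_of_rel (n := n) (by rwa [Ne, reflect_eq_zero_iff])
      (natDegree_reflect_le_of_le hP) hP hrel
    omega

theorem eq_of_sum_mul_eq (D : ℕ → ℕ) (n : ℕ) (h : ∀ m < n, ∑ e ∈ Finset.range (m + 1),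
    D e * (2 ^ ((m - e) / 2 + 1) - 1) = 2 ^ (m + 1) - 1) :
    (0 < n → D 0 = 1) ∧ (1 < n → D 1 = 2) ∧ ∀ d, 2 ≤ d → d < n → D d = 2 ^ (d - 1) := by
  have h0 : 0 < n → D 0 = 1 := fun hn => by simpa using h 0 hn
  have h1 : 1 < n → D 1 = 2 := fun hn => by
    have := h 1 hn
    simp [Finset.sum_range_succ, h0 (by omega)] at this
    omega
  refine ⟨h0, h1, ?_⟩
  intro d hd hdn
  obtain ⟨m, rfl⟩ : ∃ m, d = m + 2 := ⟨d - 2, by omega⟩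
  rcases Nat.eq_zero_or_pos m with rfl | hm
  · have := h 2 hdn
    simp [Finset.sum_range_succ, h0 (by omega), h1 (by omega)] at this
    simp
    omega
  obtain ⟨m, rfl⟩ : ∃ k, m = k + 1 := ⟨m - 1, by omega⟩
  have hz : ∀ m < n, ∑ e ∈ Finset.range (m + 1),
      (D e : ℤ) * (2 ^ ((m - e) / 2 + 1) - 1) = 2 ^ (m + 1) - 1 := by
    intro m hm
    have := congrArg (Nat.cast : ℕ → ℤ) (h m hm)
    rw [Nat.cast_sum, Nat.cast_sub Nat.one_le_two_pow] at this
    push_cast at this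
    rw [← this]
    refine Finset.sum_congr rfl fun e _ => ?_
    rw [Nat.cast_sub Nat.one_le_two_pow]
    push_cast
    rfl
  have e0 := hz m (by omega)
  have e1 := hz (m + 1) (by omega)
  have e2 := hz (m + 2) (by omega)
  have e3 := hz (m + 3) (by omega)
  rw [Finset.sum_range_succ] at e1
  rw [Finset.sum_range_succ, Finset.sum_range_succ] at e2
  rw [Finset.sum_range_succ, Finset.sum_range_succ, Finset.sum_range_succ] at e3
  -- The weights `w(k) = 2^(⌊k/2⌋+1) - 1` satisfy `w(k+3) - w(k+2) - 2w(k+1) + 2w(k) = 0`. In the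
  -- same combination of the four equations the terms at `m + 1` and `m + 2` cancel too, leaving `D
  -- (m + 3)`.
  have key : ∑ e ∈ Finset.range (m + 1), (D e : ℤ) * (2 ^ ((m + 3 - e) / 2 + 1) - 1) -
      ∑ e ∈ Finset.range (m + 1), (D e : ℤ) * (2 ^ ((m + 2 - e) / 2 + 1) - 1) -
      2 * ∑ e ∈ Finset.range (m + 1), (D e : ℤ) * (2 ^ ((m + 1 - e) / 2 + 1) - 1) +
      2 * ∑ e ∈ Finset.range (m + 1), (D e : ℤ) * (2 ^ ((m - e) / 2 + 1) - 1) = 0 := by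
    rw [Finset.mul_sum, Finset.mul_sum, ← Finset.sum_sub_distrib, ← Finset.sum_sub_distrib,
      ← Finset.sum_add_distrib]
    refine Finset.sum_eq_zero fun e he => ?_
    obtain ⟨k, rfl⟩ : ∃ k, m = e + k := ⟨m - e, by have := Finset.mem_range.1 he; omega⟩
    rw [show (e + k + 3 - e) / 2 + 1 = (k + 1) / 2 + 1 + 1 by omega,
      show (e + k + 2 - e) / 2 + 1 = k / 2 + 1 + 1 by omega,
      show (e + k + 1 - e) / 2 + 1 = (k + 1) / 2 + 1 by omega,
      show (e + k - e) / 2 + 1 = k / 2 + 1 by omega, pow_succ _ ((k + 1) / 2 + 1),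
      pow_succ _ (k / 2 + 1)]
    ring
  simp only [show m + 1 - (m + 1) = 0 by omega, show m + 2 - (m + 1) = 1 by omega,
    show m + 2 - (m + 1 + 1) = 0 by omega, show m + 3 - (m + 1) = 2 by omega,
    show m + 3 - (m + 1 + 1) = 1 by omega, show m + 3 - (m + 1 + 1 + 1) = 0 by omega] at e1 e2 e3
  norm_num at e1 e2 e3
  have : (D (m + 3) : ℤ) = 2 ^ (m + 2) := by
    rw [show m + 1 + 1 + 1 = m + 3 by omega, show m + 1 + 1 = m + 2 by omega] at *
    have p1 : (2 : ℤ) ^ (m + 3 + 1) = 8 * 2 ^ (m + 1) := by ring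
    have p2 : (2 : ℤ) ^ (m + 3) = 4 * 2 ^ (m + 1) := by ring
    have p3 : (2 : ℤ) ^ (m + 2) = 2 * 2 ^ (m + 1) := by ring
    have p4 : (2 : ℤ) ^ (m + 2 + 1) = 4 * 2 ^ (m + 1) := by ring
    linarith
  rw [show m + 1 + 2 - 1 = m + 2 by omega]
  exact_mod_cast this

end Counting

/-! ### Membership in the code and in its dual, in terms of polynomials. -/

section Sequences

variable {n t : ℕ} {s u : ℕ → ZMod 2} {f p : (ZMod 2)[X]}

/-- The linear functional on polynomials sending `X ^ j` to `s j`. -/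
noncomputable def seqEval (s : ℕ → ZMod 2) : (ZMod 2)[X] →ₗ[ZMod 2] ZMod 2 :=
  Polynomial.lsum fun j => LinearMap.toSpanSingleton (ZMod 2) (ZMod 2) (s j)

theorem seqEval_monomial (s : ℕ → ZMod 2) (j : ℕ) (a : ZMod 2) :
    seqEval s (monomial j a) = a * s j := by
  simp [seqEval, lsum_apply, sum_monomial_index]

theorem seqEval_eq_sum (s : ℕ → ZMod 2) (hp : p.natDegree < t) :
    seqEval s p = ∑ j ∈ Finset.range t, p.coeff j * s j := by
  conv_lhs => rw [p.as_sum_range' t hp]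
  rw [map_sum]
  exact Finset.sum_congr rfl fun j _ => seqEval_monomial _ _ _

theorem seqEval_X_pow_mul (s : ℕ → ZMod 2) (i : ℕ) (p : (ZMod 2)[X]) :
    seqEval s (X ^ i * p) = seqEval (fun j => s (i + j)) p := by
  induction p using Polynomial.induction_on' with
  | add p q hp hq => rw [mul_add, map_add, map_add, hp, hq]
  | monomial j a => rw [X_pow_mul_monomial, seqEval_monomial, seqEval_monomial, add_comm]

/-- The first `t` terms of `u` satisfy the linear recurrence of order `n` with characteristic
polynomial `f`. -/
def IsRecurrentUpTo (f : (ZMod 2)[X]) (n t : ℕ) (u : ℕ → ZMod 2) : Prop :=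
  ∀ j, j + n < t → ∑ i ∈ Finset.range (n + 1), f.coeff i * u (j + i) = 0

theorem IsRecurrentUpTo.eq_zero (hf : f.coeff n = 1) (h : IsRecurrentUpTo f n t u)
    (h0 : ∀ k < n, u k = 0) : ∀ k < t, u k = 0 := by
  intro k
  induction k using Nat.strong_induction_on with
  | _ k ih =>
    intro hk
    rcases Nat.lt_or_ge k n with hkn | hkn
    · exact h0 k hkn
    · have h1 := h (k - n) (by omega)
      rw [Finset.sum_range_succ, hf, one_mul, Nat.sub_add_cancel hkn,
        Finset.sum_eq_zero, zero_add] at h1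
      · exact h1
      · intro i hi
        rw [Finset.mem_range] at hi
        rw [ih _ (by omega) (by omega), mul_zero]

theorem seqEval_mul_eq_zero (hfd : f.natDegree = n) (hs : ∀ t, IsRecurrentUpTo f n t s)
    (q : (ZMod 2)[X]) : seqEval s (q * f) = 0 := by
  induction q using Polynomial.induction_on' with
  | add p q hp hq => rw [add_mul, map_add, hp, hq, add_zero]
  | monomial j a =>
    rw [← C_mul_X_pow_eq_monomial, mul_assoc, ← smul_eq_C_mul, map_smul, seqEval_X_pow_mul,
      seqEval_eq_sum _ (hfd.trans_lt (Nat.lt_succ_self n)), hs _ j (Nat.lt_succ_self _), smul_zero]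

/-- If `f` did not divide `p`, a Bézout relation would make `seqEval s` vanish on every `X^j`, that
is, `s = 0`. -/
theorem dvd_of_seqEval (hf : Irreducible f) (hfd : f.natDegree = n)
    (hs : ∀ t, IsRecurrentUpTo f n t s) (hs0 : s ≠ 0)
    (h : ∀ q, seqEval s (q * p) = 0) : f ∣ p := by
  by_contra hnd
  obtain ⟨a, b, hab⟩ := hf.coprime_iff_not_dvd.2 hnd
  refine hs0 (funext fun j => ?_)
  have h1 : seqEval s (X ^ j) = s j := by
    rw [← monomial_one_right_eq_X_pow, seqEval_monomial, one_mul]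
  rw [← h1, ← mul_one (X ^ j), ← hab, mul_add, ← mul_assoc, ← mul_assoc, map_add, h,
    seqEval_mul_eq_zero hfd hs, add_zero, Pi.zero_apply]

theorem seqEval_mul_eq_zero_of_lt (hf : f.Monic) (hfd : f.natDegree = n) (hn : 0 < n)
    (hs : ∀ t, IsRecurrentUpTo f n t s) (h : ∀ i < n, seqEval s (X ^ i * p) = 0)
    (q : (ZMod 2)[X]) : seqEval s (q * p) = 0 := by
  rw [← modByMonic_add_div q f, add_mul, map_add, mul_comm f, mul_assoc, mul_comm f, ← mul_assoc,
    seqEval_mul_eq_zero hfd hs, add_zero]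
  have hd : (q %ₘ f).natDegree < n := by
    rw [← hfd]
    refine natDegree_modByMonic_lt q hf ?_
    rintro rfl
    simp at hfd
    omega
  rw [(q %ₘ f).as_sum_range' n hd, Finset.sum_mul, map_sum]
  refine Finset.sum_eq_zero fun i hi => ?_
  rw [← C_mul_X_pow_eq_monomial, mul_assoc, ← smul_eq_C_mul, map_smul, h i (Finset.mem_range.1 hi),
    smul_zero]

theorem coeff_reflect_mul (hfd : f.natDegree ≤ n) (p : (ZMod 2)[X]) (j : ℕ) :
    (reflect n f * p).coeff (j + n) = ∑ i ∈ Finset.range (n + 1), f.coeff i * p.coeff (j + i) := by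
  have h : reflect n f = ∑ i ∈ Finset.range (n + 1), C (f.coeff i) * X ^ (n - i) := by
    ext k
    rw [coeff_reflect, finsetSum_coeff]
    simp only [coeff_C_mul, coeff_X_pow]
    rcases Nat.lt_or_ge n k with hk | hk
    · rw [revAt_eq_self_of_lt hk, coeff_eq_zero_of_natDegree_lt (hfd.trans_lt hk),
        Finset.sum_eq_zero]
      intro i _
      rw [if_neg (by omega), mul_zero]
    · rw [revAt_le hk, Finset.sum_eq_single (n - k)]
      · rw [if_pos (by omega), mul_one]
      · intro i hi hne
        rw [Finset.mem_range] at hi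
        rw [if_neg (by omega), mul_zero]
      · intro hi
        rw [Finset.mem_range] at hi
        omega
  rw [h, Finset.sum_mul, finsetSum_coeff]
  refine Finset.sum_congr rfl fun i hi => ?_
  rw [Finset.mem_range] at hi
  rw [mul_assoc, coeff_C_mul, coeff_X_pow_mul', if_pos (by omega)]
  congr 2
  omega

/-- The word of length `t` formed by the coefficients of a polynomial. -/
noncomputable def word (t : ℕ) : (ZMod 2)[X] →ₗ[ZMod 2] (Fin t → ZMod 2) :=
  LinearMap.pi fun j => lcoeff (ZMod 2) j

theorem word_apply (p : (ZMod 2)[X]) (j : Fin t) : word t p j = p.coeff j := rfl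

theorem exists_word_eq (ht : 0 < t) (w : Fin t → ZMod 2) :
    ∃ p : (ZMod 2)[X], p.natDegree < t ∧ word t p = w := by
  refine ⟨(degreeLTEquiv (ZMod 2) t).symm w, ?_, funext fun j => coeff_degreeLTEquiv_symm w j⟩
  have h := mem_degreeLT.1 ((degreeLTEquiv (ZMod 2) t).symm w).2
  rcases eq_or_ne ((degreeLTEquiv (ZMod 2) t).symm w : (ZMod 2)[X]) 0 with h0 | h0
  · rw [h0, natDegree_zero]
    exact ht
  · exact (natDegree_lt_iff_degree_lt h0).2 h

theorem eq_of_word_eq {q : (ZMod 2)[X]} (hp : p.natDegree < t) (hq : q.natDegree < t)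
    (h : word t p = word t q) : p = q := by
  ext j
  rcases Nat.lt_or_ge j t with hj | hj
  · exact congrFun h ⟨j, hj⟩
  · rw [coeff_eq_zero_of_natDegree_lt (by omega), coeff_eq_zero_of_natDegree_lt (by omega)]

theorem word_mem_dualCode_iff (hf : Irreducible f) (hfm : f.Monic) (hfd : f.natDegree = n)
    (hs : ∀ t, IsRecurrentUpTo f n t s) (hs0 : s ≠ 0) (hp : p.natDegree < t) :
    word t p ∈ dualCode (code s n t) ↔ f ∣ p := by
  have hn : 0 < n := hfd ▸ hf.natDegree_pos
  have hrow : ∀ i, ∑ r : Fin t, s (i + r) * word t p r = seqEval s (X ^ i * p) := by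
    intro i
    rw [seqEval_X_pow_mul, seqEval_eq_sum _ hp, ← Fin.sum_univ_eq_sum_range
      (fun j => p.coeff j * s (i + j))]
    exact Finset.sum_congr rfl fun r _ => mul_comm _ _
  rw [mem_dualCode]
  constructor
  · intro h
    refine dvd_of_seqEval hf hfd hs hs0 (seqEval_mul_eq_zero_of_lt hfm hfd hn hs fun i hi => ?_)
    rw [← hrow]
    exact h _ (Submodule.subset_span ⟨⟨i, hi⟩, rfl⟩)
  · rintro ⟨q, rfl⟩ w hw
    rw [code, codeGeneratedBy] at hw
    induction hw using Submodule.span_induction with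
    | mem w hw =>
      obtain ⟨i, rfl⟩ := hw
      have := hrow i
      rw [mul_comm f, ← mul_assoc, seqEval_mul_eq_zero hfd hs] at this
      rw [mul_comm f]
      exact this
    | zero => simp
    | add x y _ _ hx hy => simp only [Pi.add_apply, add_mul, Finset.sum_add_distrib, hx, hy, add_zero]
    | smul a x _ hx => simp only [Pi.smul_apply, smul_eq_mul, mul_assoc, ← Finset.mul_sum, hx, mul_zero]

theorem isRecurrentUpTo_sum (hs : ∀ t, IsRecurrentUpTo f n t s) (c : Fin n → ZMod 2) (t : ℕ) :
    IsRecurrentUpTo f n t fun k => ∑ i, c i * s (i + k) := by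
  intro j _
  simp only [Finset.mul_sum]
  rw [Finset.sum_comm]
  refine Finset.sum_eq_zero fun i _ => ?_
  have h := hs (i + j + n + 1) (i + j) (by omega)
  calc ∑ k ∈ Finset.range (n + 1), f.coeff k * (c i * s (i + (j + k)))
      = c i * ∑ k ∈ Finset.range (n + 1), f.coeff k * s (i + j + k) := by
        rw [Finset.mul_sum]
        refine Finset.sum_congr rfl fun k _ => ?_
        rw [add_assoc]; ring
    _ = 0 := by rw [h, mul_zero]

/-- A row dependency holds on the first `n` columns, hence everywhere by recurrence. Its coefficient
polynomial is then divisible by `f` but has degree below `n`. -/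
theorem linearIndependent_observabilityMatrix (hf : Irreducible f) (hfm : f.Monic)
    (hfd : f.natDegree = n) (hs : ∀ t, IsRecurrentUpTo f n t s) (hs0 : s ≠ 0) (ht : n ≤ t) :
    LinearIndependent (ZMod 2) fun i => observabilityMatrix s n t i := by
  have hn : 0 < n := hfd ▸ hf.natDegree_pos
  rw [Fintype.linearIndependent_iff]
  intro c hc
  have hcn : f.coeff n = 1 := hfd ▸ hfm.coeff_natDegree
  have hzero : ∀ k, ∑ i, c i * s (i + k) = 0 := by
    intro k
    refine (isRecurrentUpTo_sum hs c (k + 1)).eq_zero hcn (fun k hk => ?_) k (Nat.lt_succ_self k)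
    have := congrFun hc ⟨k, by omega⟩
    simpa [observabilityMatrix] using this
  obtain ⟨a, ha, hac⟩ := exists_word_eq hn c
  have hdvd : f ∣ a := by
    refine dvd_of_seqEval hf hfd hs hs0 (seqEval_mul_eq_zero_of_lt hfm hfd hn hs fun k _ => ?_)
    rw [seqEval_X_pow_mul, seqEval_eq_sum _ ha, ← Fin.sum_univ_eq_sum_range
      (fun j => a.coeff j * s (k + j)), ← hzero k]
    refine Finset.sum_congr rfl fun i _ => ?_
    rw [← hac, word_apply, add_comm]
  have ha0 : a = 0 := eq_zero_of_dvd_of_natDegree_lt hdvd (by omega)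
  intro i
  rw [← hac, ha0, map_zero, Pi.zero_apply]

theorem finrank_code (hf : Irreducible f) (hfm : f.Monic)
    (hfd : f.natDegree = n) (hs : ∀ t, IsRecurrentUpTo f n t s) (hs0 : s ≠ 0) (ht : n ≤ t) :
    Module.finrank (ZMod 2) (code s n t) = n :=
  (finrank_span_eq_card (linearIndependent_observabilityMatrix hf hfm hfd hs hs0 ht)).trans
    (Fintype.card_fin n)

theorem mem_code_iff_exists (w : Fin t → ZMod 2) :
    w ∈ code s n t ↔ ∃ c : Fin n → ZMod 2, ∀ k : Fin t, ∑ i, c i * s (i + k) = w k := by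
  rw [code, codeGeneratedBy, Submodule.mem_span_range_iff_exists_fun]
  refine exists_congr fun c => ?_
  rw [funext_iff]
  refine forall_congr' fun k => ?_
  simp [observabilityMatrix]

/-- A recurrent word is determined by its first `n` terms, and these are arbitrary since the code of
length `n` is the full space. -/
theorem mem_code_iff (hf : Irreducible f) (hfm : f.Monic)
    (hfd : f.natDegree = n) (hs : ∀ t, IsRecurrentUpTo f n t s) (hs0 : s ≠ 0)
    (u : ℕ → ZMod 2) :
    (fun j : Fin t => u j) ∈ code s n t ↔ IsRecurrentUpTo f n t u := by
  have hcn : f.coeff n = 1 := hfd ▸ hfm.coeff_natDegree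
  rw [mem_code_iff_exists]
  constructor
  · rintro ⟨c, hc⟩ j hj
    rw [← isRecurrentUpTo_sum hs c t j hj]
    refine Finset.sum_congr rfl fun i hi => ?_
    rw [Finset.mem_range] at hi
    rw [← hc ⟨j + i, by omega⟩]
  · intro h
    have htop : code s n n = ⊤ := Submodule.eq_top_of_finrank_eq (by
      rw [finrank_code hf hfm hfd hs hs0 le_rfl, Module.finrank_fin_fun])
    have hmem : (fun j : Fin n => u j) ∈ code s n n := htop ▸ Submodule.mem_top
    obtain ⟨c, hc⟩ := (mem_code_iff_exists _).1 hmem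
    refine ⟨c, fun k => sub_eq_zero.1 ?_⟩
    have hrec : IsRecurrentUpTo f n t fun k => (∑ i, c i * s (i + k)) - u k := by
      intro j hj
      simp only [mul_sub, Finset.sum_sub_distrib, h j hj, sub_zero]
      exact isRecurrentUpTo_sum hs c t j hj
    exact hrec.eq_zero hcn (fun k hk => sub_eq_zero.2 (hc ⟨k, hk⟩)) k k.2

/-- The coefficients of `f* p` in positions `n, …, t - 1` are exactly the recurrence checks on `p`.
When they vanish, only a low block `B` and a high block starting at `X^t` survive. -/
theorem word_mem_code_iff (hf : Irreducible f) (hfm : f.Monic)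
    (hfd : f.natDegree = n) (hs : ∀ t, IsRecurrentUpTo f n t s) (hs0 : s ≠ 0) (ht : n ≤ t)
    (hp : p.natDegree < t) :
    word t p ∈ code s n t ↔ ∃ A B : (ZMod 2)[X], A.natDegree < n ∧ B.natDegree < n ∧
      reflect n f * p = B - X ^ t * A := by
  have hn : 0 < n := hfd ▸ hf.natDegree_pos
  refine (mem_code_iff hf hfm hfd hs hs0 p.coeff).trans ?_
  have hco := coeff_reflect_mul hfd.le p
  have hQ : (reflect n f * p).natDegree < n + t := by
    have h1 := natDegree_mul_le (p := reflect n f) (q := p)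
    have h2 := natDegree_reflect_le_of_le hfd.le
    omega
  have hsum : ∀ (v : ℕ → ZMod 2) (k : ℕ), (∑ i ∈ Finset.range n, monomial i (v i)).coeff k =
      if k < n then v k else 0 := by
    intro v k
    simp [finsetSum_coeff, coeff_monomial]
  have hdeg : ∀ v : ℕ → ZMod 2, (∑ i ∈ Finset.range n, monomial i (v i)).natDegree < n := by
    intro v
    refine (natDegree_sum_le_of_forall_le (n := n - 1) _ _ fun i hi => ?_).trans_lt (by omega)
    have := Finset.mem_range.1 hi
    exact (natDegree_monomial_le _).trans (by omega)
  set Q := reflect n f * p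
  constructor
  · intro h
    refine ⟨∑ i ∈ Finset.range n, monomial i (-Q.coeff (t + i)),
      ∑ i ∈ Finset.range n, monomial i (Q.coeff i), hdeg _, hdeg _, ?_⟩
    ext k
    rw [coeff_sub, hsum, coeff_X_pow_mul', hsum]
    rcases Nat.lt_or_ge k n with hk | hk
    · rw [if_pos hk, if_neg (by omega), sub_zero]
    · rw [if_neg (by omega)]
      rcases Nat.lt_or_ge k t with hkt | hkt
      · rw [if_neg (by omega), sub_zero]
        have := hco (k - n)
        rw [Nat.sub_add_cancel hk, h (k - n) (by omega)] at this
        exact this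
      · rw [if_pos hkt]
        split_ifs with h2
        · rw [Nat.add_sub_cancel' hkt, zero_sub, neg_neg]
        · rw [sub_zero]
          exact coeff_eq_zero_of_natDegree_lt (by omega)
  · rintro ⟨A, B, hA, hB, hAB⟩ j hj
    rw [← hco, hAB, coeff_sub, coeff_X_pow_mul', if_neg (by omega), sub_zero]
    exact coeff_eq_zero_of_natDegree_lt (by omega)

end Sequences

/-! ### The dimension of the hull. -/

section Hull

variable {n t : ℕ} {K : Type*} [Field K] [Algebra (ZMod 2) K] {α : K} {f : (ZMod 2)[X]}

theorem exists_eq_reflect_mul (hα0 : α ≠ 0) (hf0 : f ≠ 0) (hfd : f.natDegree = n)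
    (hfα : ∀ q, aeval α q = 0 ↔ f ∣ q) {q : (ZMod 2)[X]} {k : ℕ} (hq : q.natDegree ≤ n + k)
    (h : aeval α⁻¹ q = 0) : ∃ c : (ZMod 2)[X], c.natDegree ≤ k ∧ q = reflect n f * c := by
  have h1 : aeval α (reflect (n + k) q) = 0 := by rw [aeval_reflect hα0 hq, h, mul_zero]
  obtain ⟨g, hg⟩ := (hfα _).1 h1
  have hgd : g.natDegree ≤ k := by
    rcases eq_or_ne g 0 with rfl | hg0
    · simp
    · have h2 := natDegree_reflect_le_of_le hq
      rw [hg, natDegree_mul hf0 hg0] at h2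
      omega
  refine ⟨reflect k g, natDegree_reflect_le_of_le hgd, ?_⟩
  rw [← reflect_mul f g hfd.le hgd, ← hg, reflect_reflect]

variable {s : ℕ → ZMod 2}

theorem word_mem_hull_iff (hn : 3 ≤ n) (hα : orderOf α = 2 ^ n - 1) (hα0 : α ≠ 0)
    (hf : Irreducible f) (hfm : f.Monic) (hfd : f.natDegree = n)
    (hfα : ∀ q, aeval α q = 0 ↔ f ∣ q) (hs : ∀ t, IsRecurrentUpTo f n t s) (hs0 : s ≠ 0)
    (ht : n ≤ t) {p : (ZMod 2)[X]} (hp : p.natDegree < t) :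
    word t p ∈ hull (code s n t) ↔ ∃ A B : (ZMod 2)[X], A.natDegree < n ∧ B.natDegree < n ∧
      reflect n f * p = B - X ^ t * A ∧ Rel α t A B := by
  have hrd := natDegree_reflect_le_of_le hfd.le
  have hfinv : aeval α⁻¹ (reflect n f) = 0 := by
    rw [aeval_reflect (inv_ne_zero hα0) hfd.le, inv_inv, (hfα f).2 dvd_rfl, mul_zero]
  -- A nonzero polynomial of degree at most `n < 2n` cannot vanish at both `α` and `α⁻¹`.
  have hfne : aeval α (reflect n f) ≠ 0 := fun h =>
    hf.ne_zero (reflect_eq_zero_iff.1 (eq_zero_of_aeval_of_aeval_inv hn hα (by omega) h hfinv))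
  rw [hull, Submodule.mem_inf, word_mem_code_iff hf hfm hfd hs hs0 ht hp,
    word_mem_dualCode_iff hf hfm hfd hs hs0 hp, ← hfα]
  constructor
  · rintro ⟨⟨A, B, hA, hB, hAB⟩, hpα⟩
    refine ⟨A, B, hA, hB, hAB, ?_, ?_⟩
    · have := congrArg (aeval α) hAB
      rw [map_mul, hpα, mul_zero, map_sub, map_mul, map_pow, aeval_X] at this
      exact sub_eq_zero.1 this.symm
    · have := congrArg (aeval α⁻¹) hAB
      rw [map_mul, hfinv, zero_mul, map_sub, map_mul, map_pow, aeval_X] at this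
      exact sub_eq_zero.1 this.symm
  · rintro ⟨A, B, hA, hB, hAB, hrel⟩
    refine ⟨⟨A, B, hA, hB, hAB⟩, ?_⟩
    have := congrArg (aeval α) hAB
    rw [map_mul, map_sub, map_mul, map_pow, aeval_X, hrel.1, sub_self] at this
    exact (mul_eq_zero.1 this).resolve_left hfne

/-- Writing `P - X^t P* = f* c` for the generator, the hull consists of the words of `g c` with `deg
g < n - d`. -/
theorem finrank_hull (hn : 3 ≤ n) (hα : orderOf α = 2 ^ n - 1) (hα0 : α ≠ 0)
    (hf : Irreducible f) (hfm : f.Monic) (hfd : f.natDegree = n)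
    (hfα : ∀ q, aeval α q = 0 ↔ f ∣ q) (hs : ∀ t, IsRecurrentUpTo f n t s) (hs0 : s ≠ 0)
    (ht : n ≤ t) : Module.finrank (ZMod 2) (hull (code s n t)) = n - idx n α t := by
  have hmem := fun {p : (ZMod 2)[X]} (hp : p.natDegree < t) =>
    word_mem_hull_iff hn hα hα0 hf hfm hfd hfα hs hs0 ht hp
  have hr0 : reflect n f ≠ 0 := by rw [Ne, reflect_eq_zero_iff]; exact hf.ne_zero
  rcases (idx_le (n := n) (α := α) (t := t)).lt_or_eq with hlt | heq
  · obtain ⟨P, hP0, hPd, hPrel, hgen⟩ := exists_generator hn hα hα0 hlt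
    set d := idx n α t
    have hRd := natDegree_reflect_le_of_le hPd
    have hrP0 : reflect d P ≠ 0 := by rwa [Ne, reflect_eq_zero_iff]
    obtain ⟨c, hcd, hc⟩ := exists_eq_reflect_mul (q := P - X ^ t * reflect d P) (k := t + d - n)
      hα0 hf.ne_zero hfd hfα
      (by
        have h1 := natDegree_sub_le P (X ^ t * reflect d P)
        have h2 := natDegree_mul_le (p := (X ^ t : (ZMod 2)[X])) (q := reflect d P)
        rw [natDegree_X_pow] at h2
        omega)
      (by rw [map_sub, map_mul, map_pow, aeval_X, hPrel.2, sub_self])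
    -- Otherwise `P = X^t P*`, although `deg P ≤ d < n ≤ t`.
    have hc0 : c ≠ 0 := by
      rintro rfl
      rw [mul_zero, sub_eq_zero] at hc
      have h2 := natDegree_mul (pow_ne_zero t X_ne_zero) hrP0
      rw [natDegree_X_pow, ← hc] at h2
      omega
    have hlt' : ∀ g : (ZMod 2)[X], g.natDegree + d < n → (g * c).natDegree < t := by
      intro g hg
      have := natDegree_mul_le (p := g) (q := c)
      omega
    have hdeg : ∀ g ∈ degreeLT (ZMod 2) (n - d), g.natDegree + d < n := by
      intro g hg
      rw [mem_degreeLT] at hg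
      rcases eq_or_ne g 0 with rfl | hg0
      · rw [natDegree_zero]; omega
      · have := (natDegree_lt_iff_degree_lt hg0).2 hg
        omega
    let φ : degreeLT (ZMod 2) (n - d) →ₗ[ZMod 2] (Fin t → ZMod 2) :=
      (word t ∘ₗ LinearMap.mulRight (ZMod 2) c) ∘ₗ (degreeLT (ZMod 2) (n - d)).subtype
    have hφ : ∀ g, φ g = word t (g * c) := fun g => rfl
    have hinj : Function.Injective φ := by
      intro g g' h
      rw [hφ, hφ] at h
      exact Subtype.ext (mul_right_cancel₀ hc0
        (eq_of_word_eq (hlt' _ (hdeg _ g.2)) (hlt' _ (hdeg _ g'.2)) h))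
    have hrange : LinearMap.range φ = hull (code s n t) := by
      ext w
      constructor
      · rintro ⟨g, rfl⟩
        have hg := hdeg _ g.2
        rw [hφ, hmem (hlt' _ hg)]
        refine ⟨g * reflect d P, g * P, natDegree_mul_le.trans_lt (by omega),
          natDegree_mul_le.trans_lt (by omega), ?_, hPrel.mul_left _⟩
        rw [mul_left_comm, ← hc]
        ring
      · intro hw
        obtain ⟨p, hp, rfl⟩ := exists_word_eq (by omega) w
        obtain ⟨A, B, hA, hB, hAB, hrel⟩ := (hmem hp).1 hw
        rcases eq_or_ne A 0 with rfl | hA0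
        · have hB0 : B = 0 := by
            by_contra hB0
            exact hrel.left_ne_zero hα hB hB0 rfl
          rw [hB0, mul_zero, sub_zero] at hAB
          rw [(mul_eq_zero.1 hAB).resolve_left hr0, map_zero]
          exact zero_mem _
        obtain ⟨g, hg, rfl, rfl⟩ := hgen A B (n - 1) (by omega) hA0 (by omega) (by omega) hrel
        have hgmem : g ∈ degreeLT (ZMod 2) (n - d) := by
          rw [mem_degreeLT]
          exact degree_le_natDegree.trans_lt (by exact_mod_cast (by omega : g.natDegree < n - d))
        refine ⟨⟨g, hgmem⟩, ?_⟩
        rw [hφ]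
        congr 1
        refine mul_left_cancel₀ hr0 ?_
        rw [hAB, mul_left_comm, ← hc]
        ring
    rw [← hrange, LinearMap.finrank_range_of_inj hinj,
      (degreeLTEquiv (ZMod 2) (n - d)).finrank_eq, Module.finrank_fin_fun]
  · rw [heq, Nat.sub_self, Submodule.finrank_eq_zero, Submodule.eq_bot_iff]
    intro w hw
    obtain ⟨p, hp, rfl⟩ := exists_word_eq (by omega) w
    obtain ⟨A, B, hA, hB, hAB, hrel⟩ := (hmem hp).1 hw
    have hA0 : A = 0 := by
      by_contra hA0
      have := idx_le_of_rel (n := n) hA0 (show A.natDegree ≤ n - 1 by omega) (by omega) hrel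
      omega
    have hB0 : B = 0 := by
      by_contra hB0
      exact hrel.left_ne_zero hα hB hB0 hA0
    rw [hA0, hB0, mul_zero, sub_zero] at hAB
    rw [(mul_eq_zero.1 hAB).resolve_left hr0, map_zero]

end Hull

/-! ### Passage to the lengths `n ≤ t ≤ 2^n - 1`. -/

section Final

variable {n : ℕ} {K : Type*} [Field K] [Algebra (ZMod 2) K] {α : K}

/-- The set of lengths of given index, in terms of the lengths below the period. -/
theorem ncard_idx_eq (hn : 3 ≤ n) (hα : orderOf α = 2 ^ n - 1) (hα0 : α ≠ 0) (e : ℕ) :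
    {t : ℕ | n ≤ t ∧ t ≤ 2 ^ n - 1 ∧ idx n α t = e}.ncard =
      if e = 0 then idxCount n α 0 else
        if e < n then idxCount n α e - 1 else idxCount n α e := by
  have hN : n < 2 ^ n - 1 := by
    have h : ∀ k, 3 + k + 1 < 2 ^ (3 + k) := by
      intro k
      induction k with
      | zero => norm_num
      | succ k ih => rw [← add_assoc, pow_succ]; omega
    have := h (n - 3)
    rw [Nat.add_sub_cancel' hn] at this
    omega
  have hidx0 : idx n α 0 = 0 := idx_of_pow_eq_one (pow_zero _)
  have hidxN : idx n α (2 ^ n - 1) = 0 := idx_of_pow_eq_one (hα ▸ pow_orderOf_eq_one α)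
  have hidx : ∀ t < n, idx n α t = t := fun t => idx_of_lt hn hα hα0
  set N := 2 ^ n - 1 with hNdef
  have hset : ∀ F : Finset ℕ, (∀ t, t ∈ F ↔ n ≤ t ∧ t ≤ N ∧ idx n α t = e) →
      {t : ℕ | n ≤ t ∧ t ≤ N ∧ idx n α t = e}.ncard = F.card := by
    intro F hF
    rw [← Set.ncard_coe_finset]
    congr 1
    ext t
    simp [hF]
  split_ifs with h0 h1
  · subst h0
    -- Index `0` loses `t = 0` and gains `t = 2^n - 1`, so its count is unchanged.
    rw [hset (((((Finset.range N).filter fun t => idx n α t = 0).erase 0)) ∪ {N}) ?_]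
    · rw [Finset.card_union_of_disjoint (by simp), Finset.card_erase_of_mem (by simp [hidx0]; omega),
        Finset.card_singleton, idxCount, Nat.sub_add_cancel]
      exact Finset.card_pos.2 ⟨0, by simp [hidx0]; omega⟩
    · intro t
      simp only [Finset.mem_union, Finset.mem_erase, Finset.mem_filter, Finset.mem_range,
        Finset.mem_singleton]
      have := hidx t
      constructor
      · rintro (⟨h1, h2, h3⟩ | rfl)
        · refine ⟨?_, by omega, h3⟩
          by_contra! h4
          omega
        · exact ⟨hN.le, le_rfl, hidxN⟩
      · rintro ⟨h1, h2, h3⟩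
        rcases h2.lt_or_eq with h4 | h4
        · exact Or.inl ⟨by omega, h4, h3⟩
        · exact Or.inr h4
  -- Each `t < n` has index `t`, so exactly `t = e` is dropped.
  · rw [hset (((Finset.range N).filter fun t => idx n α t = e).erase e) ?_]
    · rw [Finset.card_erase_of_mem (by simp [hidx e h1]; omega), idxCount]
    · intro t
      simp only [Finset.mem_erase, Finset.mem_filter, Finset.mem_range]
      have := hidx t
      constructor
      · rintro ⟨h1, h2, h3⟩
        refine ⟨?_, by omega, h3⟩
        by_contra! h4
        omega
      · rintro ⟨h1, h2, h3⟩
        refine ⟨by omega, ?_, h3⟩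
        rcases h2.lt_or_eq with h4 | rfl
        · exact h4
        · omega
  · rw [hset ((Finset.range N).filter fun t => idx n α t = e) ?_, idxCount]
    intro t
    simp only [Finset.mem_filter, Finset.mem_range]
    have := hidx t
    constructor
    · rintro ⟨h2, h3⟩
      refine ⟨?_, by omega, h3⟩
      by_contra! h4
      omega
    · rintro ⟨h1, h2, h3⟩
      refine ⟨?_, h3⟩
      rcases h2.lt_or_eq with h4 | rfl
      · exact h4
      · omega

/-- Indices below `n` come from the triangular system; they total `2^(n-1) + 1`, and index `n` takes
the remainder of `2^n - 1`. -/
theorem idxCount_values (hn : 3 ≤ n) (hα : orderOf α = 2 ^ n - 1) (hα0 : α ≠ 0)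
    (hgen : ∀ x : K, x ≠ 0 → ∃ k : ℕ, α ^ k = x) :
    idxCount n α 0 = 1 ∧ idxCount n α 1 = 2 ∧
      (∀ d, 2 ≤ d → d < n → idxCount n α d = 2 ^ (d - 1)) ∧
      idxCount n α n = 2 ^ (n - 1) - 2 := by
  obtain ⟨h0, h1, h2⟩ := eq_of_sum_mul_eq (idxCount n α) n
    fun m hm => sum_idxCount_mul hn hα hα0 hgen hm
  refine ⟨h0 (by omega), h1 (by omega), h2, ?_⟩
  have htot : ∑ e ∈ Finset.range (n + 1), idxCount n α e = 2 ^ n - 1 := by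
    have := Finset.card_eq_sum_card_fiberwise (s := Finset.range (2 ^ n - 1))
      (t := Finset.range (n + 1)) (f := fun t => idx n α t)
      (fun t _ => by simpa using Nat.lt_succ_of_le idx_le)
    rw [Finset.card_range] at this
    exact this.symm
  have hpart : ∀ k, 2 + k ≤ n → ∑ e ∈ Finset.range (2 + k), idxCount n α e = 2 ^ (k + 1) + 1 := by
    intro k
    induction k with
    | zero => intro _; simp [Finset.sum_range_succ, h0 (by omega), h1 (by omega)]
    | succ k ih =>
      intro hk
      rw [← add_assoc, Finset.sum_range_succ, ih (by omega), h2 (2 + k) (by omega) (by omega),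
        show 2 + k - 1 = k + 1 by omega, pow_succ _ (k + 1)]
      omega
  have h3 := hpart (n - 2) (by omega)
  rw [show 2 + (n - 2) = n by omega, show n - 2 + 1 = n - 1 by omega] at h3
  rw [Finset.sum_range_succ, h3] at htot
  have h4 : 2 ^ n = 2 * 2 ^ (n - 1) := by rw [← pow_succ']; congr 1; omega
  omega

/-- An m-sequence, described by a primitive element and its minimal polynomial. -/
theorem IsMSequence.exists_primitive {s : ℕ → ZMod 2} (hn : 3 ≤ n) (hs : IsMSequence n s) :
    ∃ (α : GaloisField 2 n) (f : (ZMod 2)[X]), orderOf α = 2 ^ n - 1 ∧ α ≠ 0 ∧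
      (∀ x : GaloisField 2 n, x ≠ 0 → ∃ k : ℕ, α ^ k = x) ∧ Irreducible f ∧ f.Monic ∧
      f.natDegree = n ∧ (∀ q, aeval α q = 0 ↔ f ∣ q) ∧ (∀ t, IsRecurrentUpTo f n t s) ∧ s ≠ 0 := by
  obtain ⟨E, hE, ⟨α, hα, hmin⟩, hsol, hs0⟩ := hs
  have hfin : Finite (GaloisField 2 n)ˣ := inferInstance
  have hcard : Nat.card (GaloisField 2 n)ˣ = 2 ^ n - 1 := by
    rw [Nat.card_units, GaloisField.card 2 n (by omega)]
  have hint : IsIntegral (ZMod 2) (α : GaloisField 2 n) := Algebra.IsIntegral.isIntegral _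
  have hdeg : E.charPoly.natDegree = n := by
    rw [natDegree_eq_of_degree_eq_some E.charPoly_degree_eq_order, hE]
  refine ⟨α, E.charPoly, ?_, α.ne_zero, ?_, hmin ▸ minpoly.irreducible hint,
    E.charPoly_monic, hdeg, fun q => ?_, fun t j _ => ?_, hs0⟩
  · rw [orderOf_units, orderOf_eq_card_of_forall_mem_zpowers hα, hcard]
  · intro x hx
    obtain ⟨k, hk⟩ := mem_powers_iff_mem_zpowers.2 (hα (Units.mk0 x hx))
    exact ⟨k, by simpa using congrArg Units.val hk⟩
  · rw [← hmin]
    exact ⟨minpoly.dvd _ _, fun ⟨g, hg⟩ => by rw [hg, map_mul, minpoly.aeval, zero_mul]⟩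
  · subst hE
    have hlead : E.charPoly.coeff E.order = 1 := by
      conv_lhs => rw [← hdeg]
      exact E.charPoly_monic.coeff_natDegree
    have hco : ∀ i : Fin E.order, E.charPoly.coeff i = -E.coeffs i := by
      intro i
      rw [LinearRecurrence.charPoly, coeff_sub, coeff_monomial, if_neg (by omega), finsetSum_coeff,
        Finset.sum_eq_single i]
      · simp
      · intro b _ hb
        rw [coeff_monomial, if_neg (fun h => hb (Fin.ext h))]
      · simp
    rw [Finset.sum_range_succ, hlead, one_mul, hsol j, ← Fin.sum_univ_eq_sum_range
      (fun i => E.charPoly.coeff i * s (j + i)), ← Finset.sum_add_distrib]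
    refine Finset.sum_eq_zero fun i _ => ?_
    rw [hco]; ring

end Final

end MSeq

theorem mainTheorem9 (n : ℕ) (hn : 3 ≤ n) (s : ℕ → ZMod 2) (hs : MSeq.IsMSequence n s) :
    MSeq.hullCount s n 0 = 2 ^ (n - 1) - 2 ∧
    (∀ h : ℕ, 1 ≤ h → h ≤ n - 2 → MSeq.hullCount s n h = 2 ^ (n - h - 1) - 1) ∧
    MSeq.hullCount s n (n - 1) = 1 ∧
    MSeq.hullCount s n n = 1 ∧
    {t : ℕ | n ≤ t ∧ t ≤ 2 ^ n - 1 ∧ MSeq.IsLCD (MSeq.code s n t)}.ncard = 2 ^ (n - 1) - 2 ∧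
    {t : ℕ | n ≤ t ∧ t ≤ 2 ^ n - 1 ∧ MSeq.IsSelfOrthogonal (MSeq.code s n t)}.ncard = 1 ∧
    MSeq.IsSelfOrthogonal (MSeq.code s n (2 ^ n - 1)) := by
  obtain ⟨α, f, hα, hα0, hgen, hf, hfm, hfd, hfα, hrec, hs0⟩ := hs.exists_primitive hn
  obtain ⟨c0, c1, cd, cn⟩ := MSeq.idxCount_values hn hα hα0 hgen
  have hrank : ∀ t, n ≤ t → Module.finrank (ZMod 2) (MSeq.hull (MSeq.code s n t)) =
      n - MSeq.idx n α t := fun t ht => MSeq.finrank_hull hn hα hα0 hf hfm hfd hfα hrec hs0 ht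
  have hcount : ∀ h ≤ n, MSeq.hullCount s n h =
      {t : ℕ | n ≤ t ∧ t ≤ 2 ^ n - 1 ∧ MSeq.idx n α t = n - h}.ncard := by
    intro h hh
    rw [MSeq.hullCount]
    congr 1
    ext t
    refine and_congr_right fun ht => and_congr_right fun _ => ?_
    rw [hrank t ht]
    have := MSeq.idx_le (n := n) (α := α) (t := t)
    omega
  have hcode : ∀ t, n ≤ t → Module.finrank (ZMod 2) (MSeq.code s n t) = n := fun t ht =>
    MSeq.finrank_code hf hfm hfd hrec hs0 ht
  -- Self-orthogonality means that the hull is the whole code, which has dimension `n`.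
  have hself : ∀ t, n ≤ t → (MSeq.IsSelfOrthogonal (MSeq.code s n t) ↔
      Module.finrank (ZMod 2) (MSeq.hull (MSeq.code s n t)) = n) := by
    intro t ht
    rw [MSeq.IsSelfOrthogonal, ← inf_eq_left, ← MSeq.hull]
    constructor
    · intro h
      rw [h, hcode t ht]
    · intro h
      exact Submodule.eq_of_le_of_finrank_eq inf_le_left (h.trans (hcode t ht).symm)
  have r0 : MSeq.hullCount s n 0 = 2 ^ (n - 1) - 2 := by
    rw [hcount 0 (by omega), MSeq.ncard_idx_eq hn hα hα0, if_neg (by omega), if_neg (by omega),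
      Nat.sub_zero, cn]
  have rn : MSeq.hullCount s n n = 1 := by
    rw [hcount n le_rfl, MSeq.ncard_idx_eq hn hα hα0, if_pos (by omega), c0]
  refine ⟨r0, ?_, ?_, rn, ?_, ?_, ?_⟩
  · intro h h1 h2
    rw [hcount h (by omega), MSeq.ncard_idx_eq hn hα hα0, if_neg (by omega), if_pos (by omega),
      cd (n - h) (by omega) (by omega)]
  · rw [hcount (n - 1) (by omega), MSeq.ncard_idx_eq hn hα hα0, if_neg (by omega),
      if_pos (by omega), show n - (n - 1) = 1 by omega, c1]
  · exact (congrArg Set.ncard (Set.ext fun t => and_congr_right fun _ =>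
      and_congr_right fun _ => Submodule.finrank_eq_zero.symm)).trans r0
  · exact (congrArg Set.ncard (Set.ext fun t =>
      and_congr_right fun ht => and_congr_right fun _ => hself t ht)).trans rn
  · have hN : n ≤ 2 ^ n - 1 := Nat.le_sub_one_of_lt Nat.lt_two_pow_self
    rw [hself _ hN, hrank _ hN, MSeq.idx_of_pow_eq_one (hα ▸ pow_orderOf_eq_one α), Nat.sub_zero]
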